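/- Let $R,G,\rho>0$ and $G',L\ge 0$. There are constants $c,K>0$, depending only on $R,G,G',L,\rho$, such that the following holds for all integers $d\ge 0$, $n\ge 2$ and all $\theta\in(0,1]$, $\alpha\in(0,\infty)$, $\delta\in(0,1)$. Let $\mathbb P$ be a probability distribution on a measurable space $\mathcal Z$, let $\mathcal W\subseteq\mathbb R^d$ be closed and convex with $\|\mathbf w\|_2\le R$ for all $\mathbf w\in\mathcal W$, and put $P(\mathbf w)=\mathbb E_{\mathbf z\sim\mathbb P}[f(\mathbf w,\mathbf z)]+r(\mathbf w)$, $P_*=\min_{\mathcal W}P$, $\mathcal W_*=\arg\min_{\mathcal W}P$, where (a) $f(\mathbf w,\cdot)$ is $\mathbb P$-integrable for each $\mathbf w\in\mathcal W$, and for each $\mathbf z\in\mathcal Z$ the loss $f(\cdot,\mathbf z)$ is $G$-Lipschitz on $\mathcal W$ and is non-negative, differentiable, convex and $L$-smooth on the open $\rho$-neighbourhood $\mathcal W^\rho$ of $\mathcal W$, i.e. $0\le f(\mathbf w,\mathbf z)-f(\mathbf u,\mathbf z)-\nabla f(\mathbf u,\mathbf z)^\top(\mathbf w-\mathbf u)\le\frac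 L2\|\mathbf w-\mathbf u\|_2^2$ for all $\mathbf w,\mathbf u\in\mathcal W^\rho$; (b) the regularizer $r$ is non-negative, convex and $G'$-Lipschitz on $\mathcal W$ (it may be nonsmooth, or zero); (c) the error bound condition EBC$(\theta,\alpha)$ holds: for every $\mathbf w\in\mathcal W$ and the point $\mathbf w^*\in\mathcal W_*$ closest to $\mathbf w$, $\|\mathbf w-\mathbf w^*\|_2^2\le\alpha\,(P(\mathbf w)-P(\mathbf w^*))^\theta$. Let $\mathbf z_1,\dots,\mathbf z_n$ be i.i.d. from $\mathbb P$, and let $\widehat{\mathbf w}$ denote any minimizer over $\mathcal W$ of the empirical risk $\frac1n\sum_{i=1}^n f(\mathbf w,\mathbf z_i)+r(\mathbf w)$. Write $C=d\log n+\log(1/\delta)$. Then with probability at least $1-\delta$, every such $\widehat{\mathbf w}$ satisfies $$P(\widehat{\mathbf w})-P_*\le K\left(\frac{C}{n}+\max(1,\alpha^{1/\theta})\left[\frac{C\,P_*}{n}\right]^{\frac1{2-\theta}}\right).$$ If moreover $n\ge c\,(\alpha^{1/\theta}d\log n)^{2-\theta}$, then with probability at least $1-\delta$, every such $\widehat{\mathbf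 w}$ satisfies $$P(\widehat{\mathbf w})-P_*\le K\max(1,\alpha^{1/\theta})\left(\left[\frac{C}{n}\right]^{\frac2{2-\theta}}+\left[\frac{C\,P_*}{n}\right]^{\frac1{2-\theta}}\right).$$ -/

import Mathlib

open MeasureTheory

noncomputable section

/-- `ℝ^d` with the Euclidean norm. -/
abbrev Vec (d : ℕ) : Type := EuclideanSpace ℝ (Fin d)

/-- The set of minimizers of `φ` over `W`. -/
def argminOn {d : ℕ} (W : Set (Vec d)) (φ : Vec d → ℝ) : Set (Vec d) :=
  {w | w ∈ W ∧ ∀ u ∈ W, φ w ≤ φ u}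

/-- The optimal value of `φ` over `W`. -/
def optValue {d : ℕ} (W : Set (Vec d)) (φ : Vec d → ℝ) : ℝ :=
  sInf (φ '' W)

/-- The risk `P(w) = 𝔼_{z ∼ μ}[f(w, z)] + r(w)`. -/
def risk {d : ℕ} {Z : Type*} [MeasurableSpace Z] (μ : Measure Z)
    (f : Vec d → Z → ℝ) (r : Vec d → ℝ) (w : Vec d) : ℝ :=
  (∫ z, f w z ∂μ) + r w

/-- The empirical risk `P_n(w) = (1/n) ∑ i, f(w, z_i) + r(w)` of the sample `z`. -/
def empRisk {d n : ℕ} {Z : Type*} (f : Vec d → Z → ℝ) (r : Vec d → ℝ)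
    (z : Fin n → Z) (w : Vec d) : ℝ :=
  (1 / (n : ℝ)) * (∑ i, f w (z i)) + r w

/-- The error bound condition `EBC(θ, α)` for minimizing `P` over `W`: every `w ∈ W` and every
minimizer `w'` of `P` over `W` that is closest to `w` satisfy
`‖w - w'‖² ≤ α (P(w) - P(w'))^θ`. -/
def ErrorBoundCondition {d : ℕ} (W : Set (Vec d)) (P : Vec d → ℝ) (θ α : ℝ) : Prop :=
  ∀ w ∈ W, ∀ w' ∈ argminOn W P, (∀ u ∈ argminOn W P, ‖w' - w‖ ≤ ‖u - w‖) →
    ‖w - w'‖ ^ 2 ≤ α * (P w - P w') ^ θ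

/-- `g` is non-negative, differentiable, convex and `L`-smooth on the open set `U`. -/
def NonnegSmoothConvexOn {d : ℕ} (U : Set (Vec d)) (L : ℝ) (g : Vec d → ℝ) : Prop :=
  (∀ w ∈ U, 0 ≤ g w) ∧ (∀ w ∈ U, DifferentiableAt ℝ g w) ∧
    ∀ w ∈ U, ∀ u ∈ U,
      0 ≤ g w - g u - inner ℝ (gradient g u) (w - u) ∧
        g w - g u - inner ℝ (gradient g u) (w - u) ≤ L / 2 * ‖w - u‖ ^ 2

/-- `g` is Lipschitz continuous with constant `G` on `W`. -/
def LipschitzBoundOn {d : ℕ} (W : Set (Vec d)) (G : ℝ) (g : Vec d → ℝ) : Prop :=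
  ∀ w ∈ W, ∀ u ∈ W, |g w - g u| ≤ G * ‖w - u‖

/-- The data `(W, μ, f, r)` of the risk minimization problem satisfy all the assumptions:
`W` is closed, convex and contained in the ball of radius `R`; the loss `f(·, z)` is integrable
in `z`, `G`-Lipschitz on `W`, and non-negative, convex and `L`-smooth on the open
`ρ`-neighbourhood of `W`; the regularizer `r` is non-negative, convex and `G'`-Lipschitz on `W`;
and the problem satisfies `EBC(θ, α)`. -/
structure RiskAssumptions {d : ℕ} {Z : Type*} [MeasurableSpace Z] (R G G' L ρ θ α : ℝ)
    (W : Set (Vec d)) (μ : Measure Z) (f : Vec d → Z → ℝ) (r : Vec d → ℝ) : Prop where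
  isClosed : IsClosed W
  convex : Convex ℝ W
  norm_le : ∀ w ∈ W, ‖w‖ ≤ R
  integrable : ∀ w ∈ W, Integrable (f w) μ
  lipschitz_loss : ∀ z, LipschitzBoundOn W G (fun w => f w z)
  smooth_loss : ∀ z, NonnegSmoothConvexOn (Metric.thickening ρ W) L (fun w => f w z)
  nonneg_reg : ∀ w ∈ W, 0 ≤ r w
  convex_reg : ConvexOn ℝ W r
  lipschitz_reg : LipschitzBoundOn W G' r
  error_bound : ErrorBoundCondition W (risk μ f r) θ α

/-- With probability at least `1 - δ` over `n` i.i.d. samples from `μ`, every empirical risk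
minimizer `w` satisfies `P(w) - P_* ≤ B`. -/
def ERMBound {d : ℕ} {Z : Type*} [MeasurableSpace Z] (n : ℕ) (δ : ℝ)
    (W : Set (Vec d)) (μ : Measure Z) (f : Vec d → Z → ℝ) (r : Vec d → ℝ) (B : ℝ) : Prop :=
  ∃ A : Set (Fin n → Z), MeasurableSet A ∧
    ENNReal.ofReal (1 - δ) ≤ Measure.pi (fun _ : Fin n => μ) A ∧
    ∀ z ∈ A, ∀ w ∈ argminOn W (empRisk f r z),
      risk μ f r w - optValue W (risk μ f r) ≤ B

/-- The complexity term `d log n + log(1/δ)`. -/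
def complexity (d n : ℕ) (δ : ℝ) : ℝ :=
  (d : ℝ) * Real.log n + Real.log (1 / δ)

end

/-!
A non-negative smooth convex loss is self-bounding: looking from `w` along the segment towards `u`,
the quadratic upper bound must stay non-negative, so `(f(w, z) - f(u, z))²` is at most a constant
times `‖w - u‖² (f(w, z) + f(u, z))`. Hence the increments of the loss have variance of order
`‖w - u‖² (P(w) + P(u))`, and Bernstein's inequality together with a union bound over the pairs of
a `1/n²`-net of `W`, which has `exp(O(d log n))` points, controls all increments of the
generalization gap simultaneously.

Let `w` be an empirical minimizer, `u` the closest minimizer of the risk, `D = ‖w - u‖`,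
`Δ = P(w) - P_*` and `x = C / n`. The gap at `w` minus the gap at `u` dominates `Δ`, so Bernstein's
bound is an inequality for `Δ` in terms of itself; solving it by AM-GM gives, up to constants,
`Δ ≤ 1/n² + D x + D √(x P_*)`. The trivial bound `D ≤ 2R` in the middle term gives the slow rate,
and the error bound condition `D² ≤ α Δ^θ` in the last two terms gives the exponents `2/(2-θ)` and
`1/(2-θ)`.
-/

open ProbabilityTheory Metric Module
open scoped NNReal

section SelfBounding

lemma sq_le_of_forall_nonneg_sub_add_sq {a q D M ρ : ℝ} (hD : 0 < D) (hM : 0 < M) (hq : 0 ≤ q)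
    (hqρ : q < M * D * ρ) (h : ∀ t, 0 ≤ t → t * D < ρ → 0 ≤ a - t * q + M / 2 * (t * D) ^ 2) :
    q ^ 2 ≤ 2 * M * D ^ 2 * a := by
  -- This `t` minimizes the quadratic.
  set t := q / (M * D ^ 2)
  have ht : t * (M * D ^ 2) = q := div_mul_cancel₀ _ (by positivity)
  have htρ : t * D < ρ := by
    refine lt_of_mul_lt_mul_left ?_ (mul_pos hM hD).le
    linarith
  have hnonneg := h t (by positivity) htρ
  have htq : t * q ≤ 2 * a := by
    have : M / 2 * (t * D) ^ 2 = t * q / 2 := by rw [← ht]; ring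
    linarith
  calc q ^ 2 = t * (M * D ^ 2) * q := by rw [ht, sq]
    _ = M * D ^ 2 * (t * q) := by ring
    _ ≤ M * D ^ 2 * (2 * a) := by gcongr
    _ = 2 * M * D ^ 2 * a := by ring

variable {E : Type*} [NormedAddCommGroup E] [NormedSpace ℝ E]

lemma sq_sub_le_of_le_of_quadratic_upper_bound {g : E → ℝ} {p : E →ₗ[ℝ] ℝ} {w u : E} {G L ρ : ℝ}
    (hG : 0 < G) (hL : 0 ≤ L) (hρ : 0 < ρ) (hnonneg : ∀ v ∈ ball w ρ, 0 ≤ g v)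
    (hupper : ∀ v ∈ ball w ρ, g v ≤ g w + p (v - w) + L / 2 * ‖v - w‖ ^ 2)
    (hlower : g w + p (u - w) ≤ g u) (hlip : g w - g u ≤ G * ‖w - u‖) (hle : g u ≤ g w) :
    (g w - g u) ^ 2 ≤ 2 * (L + 2 * G / ρ) * ‖w - u‖ ^ 2 * g w := by
  rcases eq_or_ne w u with rfl | hne
  · simp
  have hD : 0 < ‖w - u‖ := norm_pos_iff.2 (sub_ne_zero.2 hne)
  -- Enlarging `L` by `2 * G / ρ` keeps the minimizing step from `w` towards `u` inside the ball.
  refine sq_le_of_forall_nonneg_sub_add_sq (ρ := ρ) hD (by positivity) (sub_nonneg.2 hle) ?_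
    fun t ht htρ => ?_
  · calc g w - g u ≤ G * ‖w - u‖ := hlip
      _ < 2 * G * ‖w - u‖ := by gcongr; linarith
      _ = 2 * G / ρ * ‖w - u‖ * ρ := by field_simp
      _ ≤ (L + 2 * G / ρ) * ‖w - u‖ * ρ := by gcongr; linarith
  have hnorm : ‖t • (u - w)‖ = t * ‖w - u‖ := by
    rw [norm_smul, Real.norm_of_nonneg ht, norm_sub_rev]
  have hball : w + t • (u - w) ∈ ball w ρ := by
    rwa [mem_ball_iff_norm, add_sub_cancel_left, hnorm]
  have hdescent := (hnonneg _ hball).trans (hupper _ hball)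
  rw [add_sub_cancel_left, map_smul, smul_eq_mul, hnorm] at hdescent
  have hlinear : t * p (u - w) ≤ t * -(g w - g u) := by gcongr; linarith
  have hquad : L / 2 * (t * ‖w - u‖) ^ 2 ≤ (L + 2 * G / ρ) / 2 * (t * ‖w - u‖) ^ 2 := by
    gcongr
    exact le_add_of_nonneg_right (by positivity)
  linarith

end SelfBounding

section Bernstein

variable {Ω : Type*} [MeasurableSpace Ω] {P : Measure Ω} [IsProbabilityMeasure P]

lemma mgf_integral_sub_le {X : Ω → ℝ} (hX : AEMeasurable X P) {b l : ℝ}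
    (hb : ∀ᵐ ω ∂P, |X ω| ≤ b) (hl : 0 ≤ l) (hlb : l * b ≤ 1) :
    mgf (fun ω => (∫ ω', X ω' ∂P) - X ω) P l ≤ Real.exp (l ^ 2 * ∫ ω, X ω ^ 2 ∂P) := by
  set m := ∫ ω, X ω ∂P with hm
  set v := ∫ ω, X ω ^ 2 ∂P with hv
  have hint : Integrable X P := .of_bound hX.aestronglyMeasurable b hb
  have hsq : Integrable (fun ω => X ω ^ 2) P :=
    .of_bound (hX.pow_const 2).aestronglyMeasurable (b ^ 2) <| hb.mono fun ω hω => by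
      rw [norm_pow]; gcongr; exact hω
  have hlin : Integrable (fun ω => 1 - l * X ω) P := (integrable_const 1).sub (hint.const_mul l)
  have hpointwise : ∀ᵐ ω ∂P, Real.exp (l * (m - X ω)) ≤
      Real.exp (l * m) * (1 - l * X ω + l ^ 2 * X ω ^ 2) := hb.mono fun ω hω => by
    rw [mul_sub, sub_eq_add_neg, Real.exp_add]
    gcongr
    have habs : |-(l * X ω)| ≤ 1 := by
      rw [abs_neg, abs_mul, abs_of_nonneg hl]
      exact (mul_le_mul_of_nonneg_left hω hl).trans hlb
    have := (le_abs_self _).trans (Real.abs_exp_sub_one_sub_id_le habs)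
    linarith
  calc mgf (fun ω => m - X ω) P l
      ≤ ∫ ω, Real.exp (l * m) * (1 - l * X ω + l ^ 2 * X ω ^ 2) ∂P :=
        integral_mono_of_nonneg (.of_forall fun ω => Real.exp_nonneg _)
          ((hlin.add (hsq.const_mul _)).const_mul _) hpointwise
    _ = Real.exp (l * m) * (-(l * m) + l ^ 2 * v + 1) := by
        rw [integral_const_mul, integral_add hlin (hsq.const_mul _),
          integral_sub (integrable_const _) (hint.const_mul l), integral_const_mul,
          integral_const_mul, integral_const, probReal_univ, ← hm, ← hv]
        simp only [smul_eq_mul]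
        ring
    _ ≤ Real.exp (l * m) * Real.exp (-(l * m) + l ^ 2 * v) := by
        gcongr
        exact Real.add_one_le_exp _
    _ = Real.exp (l ^ 2 * v) := by rw [← Real.exp_add]; congr 1; ring

lemma exists_mul_le_one_and_sq_mul_add_le {b V t : ℝ} (hb : 0 < b) (hV : 0 ≤ V) (ht : 0 ≤ t) :
    ∃ l, 0 ≤ l ∧ l * b ≤ 1 ∧ l ^ 2 * V + t ≤ l * (2 * √(V * t) + b * t) := by
  -- The witness is the Chernoff parameter `min (1 / b) √(t / V)`.
  rw [Real.sqrt_mul hV]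
  nth_rewrite 1 [← Real.sq_sqrt hV]
  nth_rewrite 1 3 [← Real.sq_sqrt ht]
  have ha := Real.sqrt_nonneg V
  have he := Real.sqrt_nonneg t
  generalize √V = a at *
  generalize √t = e at *
  rcases le_or_gt a (b * e) with h | h
  · refine ⟨1 / b, by positivity, (one_div_mul_cancel hb.ne').le, ?_⟩
    have hle : 1 / b * a ≤ e := by rwa [one_div_mul_eq_div, div_le_iff₀' hb]
    have hlin : 1 / b * (b * e ^ 2) = e ^ 2 := by field_simp
    nlinarith [show 0 ≤ 1 / b * a by positivity]
  · have ha' : 0 < a := lt_of_le_of_lt (by positivity) h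
    refine ⟨e / a, by positivity, ?_, ?_⟩
    · rw [div_mul_eq_mul_div, div_le_one ha']; linarith
    · have hsq : (e / a) ^ 2 * a ^ 2 = e ^ 2 := by field_simp
      have hlin : e / a * (2 * (a * e)) = 2 * e ^ 2 := by field_simp
      linarith [show 0 ≤ e / a * (b * e ^ 2) by positivity]

lemma measure_sum_integral_sub_ge_le_of_iIndepFun {ι : Type*} {X : ι → Ω → ℝ}
    (hindep : iIndepFun X P) (hX : ∀ i, AEMeasurable (X i) P) (s : Finset ι) {b V t : ℝ}
    (hb0 : 0 < b) (hb : ∀ i ∈ s, ∀ᵐ ω ∂P, |X i ω| ≤ b) (hV : ∑ i ∈ s, ∫ ω, X i ω ^ 2 ∂P ≤ V)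
    (ht : 0 ≤ t) :
    P.real {ω | 2 * √(V * t) + b * t ≤ ∑ i ∈ s, ((∫ ω', X i ω' ∂P) - X i ω)} ≤
      Real.exp (-t) := by
  have hV0 : 0 ≤ V :=
    (Finset.sum_nonneg fun i _ => integral_nonneg fun ω => sq_nonneg (X i ω)).trans hV
  obtain ⟨l, hl, hlb, hle⟩ := exists_mul_le_one_and_sq_mul_add_le hb0 hV0 ht
  set Y : ι → Ω → ℝ := fun i ω => (∫ ω', X i ω' ∂P) - X i ω
  have hYm : ∀ i, AEMeasurable (Y i) P := fun i => (hX i).const_sub _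
  have hYindep : iIndepFun Y P :=
    hindep.comp (fun i x => (∫ ω', X i ω' ∂P) - x) fun i => by fun_prop
  have hsum : ∀ ω, (∑ i ∈ s, Y i) ω = ∑ i ∈ s, Y i ω := fun ω => Finset.sum_apply ω s Y
  have hYb : ∀ᵐ ω ∂P, (∑ i ∈ s, Y i) ω ≤ ∑ i ∈ s, ((∫ ω', X i ω' ∂P) + b) := by
    filter_upwards [(Finset.eventually_all s).2 hb] with ω hω
    rw [hsum]
    exact Finset.sum_le_sum fun i hi => by linarith [neg_abs_le (X i ω), hω i hi]
  have hint : Integrable (fun ω => Real.exp (l * (∑ i ∈ s, Y i) ω)) P :=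
    integrable_exp_mul_of_le l _ hl (by fun_prop) hYb
  have hmgf : mgf (∑ i ∈ s, Y i) P l ≤ Real.exp (l ^ 2 * V) :=
    calc mgf (∑ i ∈ s, Y i) P l = ∏ i ∈ s, mgf (Y i) P l := hYindep.mgf_sum₀ hYm s
      _ ≤ ∏ i ∈ s, Real.exp (l ^ 2 * ∫ ω, X i ω ^ 2 ∂P) :=
        Finset.prod_le_prod (fun i _ => mgf_nonneg)
          fun i hi => mgf_integral_sub_le (hX i) (hb i hi) hl hlb
      _ = Real.exp (l ^ 2 * ∑ i ∈ s, ∫ ω, X i ω ^ 2 ∂P) := by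
        rw [← Real.exp_sum, Finset.mul_sum]
      _ ≤ Real.exp (l ^ 2 * V) := by gcongr
  calc P.real {ω | 2 * √(V * t) + b * t ≤ ∑ i ∈ s, Y i ω}
      = P.real {ω | 2 * √(V * t) + b * t ≤ (∑ i ∈ s, Y i) ω} := by simp only [hsum]
    _ ≤ Real.exp (-l * (2 * √(V * t) + b * t)) * mgf (∑ i ∈ s, Y i) P l :=
        measure_ge_le_exp_mul_mgf _ hl hint
    _ ≤ Real.exp (-l * (2 * √(V * t) + b * t)) * Real.exp (l ^ 2 * V) := by gcongr
    _ = Real.exp (-l * (2 * √(V * t) + b * t) + l ^ 2 * V) := (Real.exp_add _ _).symm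
    _ ≤ Real.exp (-t) := by gcongr; linarith

lemma exists_measurableSet_forall_notMem {ι : Type*} {s : Finset ι} {bad : ι → Set Ω} {δ : ℝ}
    (hbad : ∑ i ∈ s, P.real (bad i) ≤ δ) :
    ∃ A, MeasurableSet A ∧ ENNReal.ofReal (1 - δ) ≤ P A ∧ ∀ ω ∈ A, ∀ i ∈ s, ω ∉ bad i := by
  set S := toMeasurable P (⋃ i ∈ s, bad i) with hS
  have hSm : MeasurableSet S := measurableSet_toMeasurable P _
  refine ⟨Sᶜ, hSm.compl, ?_, fun ω hω i hi hωi =>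
    hω (subset_toMeasurable P _ (Set.mem_biUnion hi hωi))⟩
  have hSδ : P.real S ≤ δ := by
    rw [hS, measureReal_def, measure_toMeasurable]
    exact (measureReal_biUnion_finset_le s bad).trans hbad
  rw [← ofReal_measureReal, probReal_compl_eq_one_sub hSm]
  gcongr

lemma measure_integral_sub_average_ge_le {Z : Type*} [MeasurableSpace Z] {μ : Measure Z}
    [IsProbabilityMeasure μ] {X : Z → ℝ} (hX : AEMeasurable X μ) {n : ℕ} (hn : 0 < n) {b V s : ℝ}
    (hb0 : 0 < b) (hb : ∀ᵐ y ∂μ, |X y| ≤ b) (hV : ∫ y, X y ^ 2 ∂μ ≤ V) (hs : 0 ≤ s) :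
    (Measure.pi fun _ : Fin n => μ).real
        {z | 2 * √(V * s) + b * s ≤ (∫ y, X y ∂μ) - 1 / (n : ℝ) * ∑ i, X (z i)} ≤
      Real.exp (-(n * s)) := by
  have hn' : (0 : ℝ) < n := Nat.cast_pos.2 hn
  have hsqrt : √(n * V * (n * s)) = n * √(V * s) := by
    rw [show n * V * (n * s) = (n : ℝ) ^ 2 * (V * s) by ring, Real.sqrt_mul (by positivity),
      Real.sqrt_sq hn'.le]
  have hbern := measure_sum_integral_sub_ge_le_of_iIndepFun (P := Measure.pi fun _ : Fin n => μ)
    (X := fun i z => X (z i)) (iIndepFun_pi fun _ => hX)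
    (fun i => hX.comp_quasiMeasurePreserving (Measure.quasiMeasurePreserving_eval _ i))
    Finset.univ (b := b) (V := n * V) (t := n * s) hb0
    (fun i _ => (Measure.quasiMeasurePreserving_eval (fun _ : Fin n => μ) i).ae hb)
    (by
      simp_rw [integral_comp_eval (μ := fun _ : Fin n => μ) (hX.pow_const 2).aestronglyMeasurable]
      rw [Finset.sum_const, Finset.card_univ, Fintype.card_fin, nsmul_eq_mul]
      gcongr)
    (by positivity)
  refine le_trans (measureReal_mono fun z hz => ?_) hbern
  simp only [Set.mem_ofPred_eq] at hz ⊢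
  simp_rw [integral_comp_eval (μ := fun _ : Fin n => μ) hX.aestronglyMeasurable]
  rw [hsqrt, Finset.sum_sub_distrib, Finset.sum_const, Finset.card_univ, Fintype.card_fin,
    nsmul_eq_mul]
  calc 2 * (n * √(V * s)) + b * (n * s) = n * (2 * √(V * s) + b * s) := by ring
    _ ≤ n * ((∫ y, X y ∂μ) - 1 / (n : ℝ) * ∑ i, X (z i)) := by gcongr
    _ = n * (∫ y, X y ∂μ) - ∑ i, X (z i) := by field_simp

end Bernstein

section Covering

variable {E : Type*} [NormedAddCommGroup E] [NormedSpace ℝ E] [FiniteDimensional ℝ E]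

lemma card_le_of_norm_le_of_isSeparated {s : Finset E} {R : ℝ} {ε : ℝ≥0} (hR : 0 ≤ R) (hε : 0 < ε)
    (hs : ∀ c ∈ s, ‖c‖ ≤ R) (hsep : IsSeparated ε (s : Set E)) :
    (s.card : ℝ) ≤ (2 * R / ε + 1) ^ finrank ℝ E := by
  borelize E
  set μ : Measure E := Measure.addHaar
  have hε' : (0 : ℝ) < ε / 2 := by positivity
  have hunit : 0 < μ.real (ball 0 1) :=
    ENNReal.toReal_pos (measure_ball_pos μ 0 one_pos).ne' measure_ball_lt_top.ne
  have hball : ∀ (c : E) {δ : ℝ}, 0 < δ →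
      μ.real (ball c δ) = δ ^ finrank ℝ E * μ.real (ball 0 1) := fun c δ hδ => by
    rw [measureReal_def, Measure.addHaar_ball_of_pos μ c hδ, ENNReal.toReal_mul,
      ENNReal.toReal_ofReal (by positivity), measureReal_def]
  have hdisj : Set.PairwiseDisjoint (s : Set E) fun c => ball c (ε / 2 : ℝ) :=
    fun c hc c' hc' hne => ball_disjoint_ball <| by
      have hlt : (ε : ENNReal) < edist c c' := hsep hc hc' hne
      rw [edist_nndist, ENNReal.coe_lt_coe] at hlt
      rw [add_halves]
      exact_mod_cast hlt.le
  have hsub : ⋃ c ∈ s, ball c (ε / 2 : ℝ) ⊆ ball 0 (R + ε / 2) :=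
    Set.iUnion₂_subset fun c hc => ball_subset_ball' <| by
      rw [dist_zero_right]; linarith [hs c hc]
  have hvol : s.card * ((ε / 2) ^ finrank ℝ E * μ.real (ball 0 1)) ≤
      (R + ε / 2) ^ finrank ℝ E * μ.real (ball 0 1) :=
    calc s.card * ((ε / 2) ^ finrank ℝ E * μ.real (ball 0 1))
        = μ.real (⋃ c ∈ s, ball c (ε / 2 : ℝ)) := by
          rw [measureReal_biUnion_finset hdisj fun c _ => measurableSet_ball]
          simp only [hball _ hε', Finset.sum_const, nsmul_eq_mul]
      _ ≤ μ.real (ball 0 (R + ε / 2)) := measureReal_mono hsub measure_ball_lt_top.ne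
      _ = (R + ε / 2) ^ finrank ℝ E * μ.real (ball 0 1) :=
          hball 0 (by positivity)
  rw [← mul_assoc, mul_le_mul_iff_left₀ hunit, ← le_div_iff₀ (by positivity), ← div_pow] at hvol
  refine hvol.trans_eq (congrArg (· ^ finrank ℝ E) ?_)
  field_simp

lemma coveringNumber_le_of_norm_le {W : Set E} {R : ℝ} {ε : ℝ≥0} (hR : 0 ≤ R) (hε : 0 < ε)
    (hW : ∀ w ∈ W, ‖w‖ ≤ R) :
    coveringNumber ε W ≤ ⌊(2 * R / ε + 1) ^ finrank ℝ E⌋₊ := by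
  refine (coveringNumber_le_packingNumber ε W).trans (iSup₂_le fun C hCW => iSup_le fun hC => ?_)
  by_contra! hcard
  obtain ⟨t, htC, ht⟩ := Set.exists_subset_encard_eq (Order.add_one_le_of_lt hcard)
  have htfin : t.Finite := Set.finite_of_encard_eq_coe ht
  lift t to Finset E using htfin
  have hle := Nat.le_floor (card_le_of_norm_le_of_isSeparated hR hε
    (fun c hc => hW c (hCW (htC hc))) (hC.subset htC))
  rw [Set.encard_coe_eq_coe_finsetCard] at ht
  norm_cast at ht
  omega

lemma exists_finset_net_of_norm_le {W : Set E} {R ε : ℝ} (hR : 0 ≤ R) (hε : 0 < ε)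
    (hW : ∀ w ∈ W, ‖w‖ ≤ R) :
    ∃ T : Finset E, ↑T ⊆ W ∧ (T.card : ℝ) ≤ (2 * R / ε + 1) ^ finrank ℝ E ∧
      ∀ w ∈ W, ∃ u ∈ T, ‖w - u‖ ≤ ε := by
  lift ε to ℝ≥0 using hε.le
  have hle := coveringNumber_le_of_norm_le hR (by exact_mod_cast hε) hW
  obtain ⟨C, hCW, hCfin, hcover, hcard⟩ :=
    exists_set_encard_eq_coveringNumber (ne_top_of_le_ne_top (ENat.natCast_ne_top _) hle)
  lift C to Finset E using hCfin
  rw [← hcard, Set.encard_coe_eq_coe_finsetCard, Nat.cast_le] at hle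
  refine ⟨C, hCW, (Nat.le_floor_iff (by positivity)).1 hle, fun w hw => ?_⟩
  obtain ⟨u, hu, hwu⟩ := hcover hw
  refine ⟨u, hu, ?_⟩
  have hle : edist w u ≤ ε := hwu
  rw [edist_nndist, ENNReal.coe_le_coe] at hle
  rw [← dist_eq_norm]
  exact_mod_cast hle

end Covering

section Loss

variable {E Z : Type*} [NormedAddCommGroup E] [MeasurableSpace Z] {W : Set E} {μ : Measure Z}
  {f : E → Z → ℝ} {G M : ℝ} {w u : E}

/-- A non-negative `G`-Lipschitz loss on `W` whose squared increments are dominated by the squared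
distance of the parameters times the sum of the two losses. Smooth convex losses have this
property, and it is all that the concentration argument uses of them. -/
structure SelfBoundingLoss (W : Set E) (μ : Measure Z) (f : E → Z → ℝ) (G M : ℝ) : Prop where
  integrable : ∀ w ∈ W, Integrable (f w) μ
  nonneg : ∀ z, ∀ w ∈ W, 0 ≤ f w z
  lipschitz : ∀ z, ∀ w ∈ W, ∀ u ∈ W, |f w z - f u z| ≤ G * ‖w - u‖
  sq_sub_le : ∀ z, ∀ w ∈ W, ∀ u ∈ W, (f w z - f u z) ^ 2 ≤ M * ‖w - u‖ ^ 2 * (f w z + f u z)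

/-- The expected loss of the parameter `w` minus its average loss over the sample `z`. -/
noncomputable def generalizationGap {E : Type*} (μ : Measure Z) (f : E → Z → ℝ) {n : ℕ}
    (z : Fin n → Z) (w : E) : ℝ :=
  (∫ y, f w y ∂μ) - 1 / (n : ℝ) * ∑ i, f w (z i)

/-- The increments of the generalization gap over `W` obey Bernstein's inequality, at deviation
level `s` and up to the resolution `ε` of a net of `W`. -/
def BernsteinDeviation (W : Set E) (μ : Measure Z) (f : E → Z → ℝ) (G M ε s : ℝ) {n : ℕ}
    (z : Fin n → Z) : Prop :=
  ∀ w ∈ W, ∀ u ∈ W, generalizationGap μ f z w - generalizationGap μ f z u ≤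
    4 * G * ε +
      2 * √(M * (‖w - u‖ + 2 * ε) ^ 2 *
        ((∫ y, f w y ∂μ) + (∫ y, f u y ∂μ) + 2 * G * ε) * s) +
      G * (‖w - u‖ + 3 * ε) * s

namespace SelfBoundingLoss

lemma integral_nonneg (hf : SelfBoundingLoss W μ f G M) (hw : w ∈ W) : 0 ≤ ∫ y, f w y ∂μ :=
  MeasureTheory.integral_nonneg fun y => hf.nonneg y w hw

lemma integral_sq_sub_le (hf : SelfBoundingLoss W μ f G M) (hw : w ∈ W) (hu : u ∈ W) :
    ∫ y, (f w y - f u y) ^ 2 ∂μ ≤ M * ‖w - u‖ ^ 2 * ((∫ y, f w y ∂μ) + ∫ y, f u y ∂μ) := by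
  have hint := (hf.integrable w hw).add (hf.integrable u hu)
  rw [← integral_add (hf.integrable w hw) (hf.integrable u hu), ← integral_const_mul]
  exact integral_mono_of_nonneg (.of_forall fun y => sq_nonneg _) (hint.const_mul _)
    (.of_forall fun y => hf.sq_sub_le y w hw u hu)

lemma abs_average_sub_le (hf : SelfBoundingLoss W μ f G M) (hw : w ∈ W) (hu : u ∈ W) {n : ℕ}
    (hn : 0 < n) (z : Fin n → Z) :
    |1 / (n : ℝ) * ∑ i, f w (z i) - 1 / (n : ℝ) * ∑ i, f u (z i)| ≤ G * ‖w - u‖ := by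
  have hn' : (0 : ℝ) < n := Nat.cast_pos.2 hn
  rw [← mul_sub, ← Finset.sum_sub_distrib, abs_mul, abs_of_pos (by positivity)]
  calc 1 / (n : ℝ) * |∑ i, (f w (z i) - f u (z i))|
      ≤ 1 / (n : ℝ) * ∑ i, |f w (z i) - f u (z i)| := by
        gcongr; exact Finset.abs_sum_le_sum_abs _ _
    _ ≤ 1 / (n : ℝ) * ∑ _i : Fin n, G * ‖w - u‖ := by
        gcongr with i; exact hf.lipschitz (z i) w hw u hu
    _ = G * ‖w - u‖ := by
        rw [Finset.sum_const, Finset.card_univ, Fintype.card_fin, nsmul_eq_mul, ← mul_assoc,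
          one_div_mul_cancel hn'.ne', one_mul]

variable [IsProbabilityMeasure μ]

lemma abs_integral_sub_le (hf : SelfBoundingLoss W μ f G M) (hw : w ∈ W) (hu : u ∈ W) :
    |(∫ y, f w y ∂μ) - ∫ y, f u y ∂μ| ≤ G * ‖w - u‖ := by
  rw [← integral_sub (hf.integrable w hw) (hf.integrable u hu)]
  simpa using norm_integral_le_of_norm_le_const (μ := μ) (f := fun y => f w y - f u y)
    (.of_forall fun y => hf.lipschitz y w hw u hu)

lemma abs_generalizationGap_sub_le (hf : SelfBoundingLoss W μ f G M) (hw : w ∈ W) (hu : u ∈ W)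
    {n : ℕ} (hn : 0 < n) (z : Fin n → Z) :
    |generalizationGap μ f z w - generalizationGap μ f z u| ≤ 2 * G * ‖w - u‖ := by
  have hint := abs_le.1 (hf.abs_integral_sub_le hw hu)
  have havg := abs_le.1 (hf.abs_average_sub_le hw hu hn z)
  unfold generalizationGap
  exact abs_le.2 ⟨by linarith, by linarith⟩

lemma measure_generalizationGap_sub_ge_le (hf : SelfBoundingLoss W μ f G M) (hw : w ∈ W)
    (hu : u ∈ W) {n : ℕ} (hn : 0 < n) {b s : ℝ} (hb : 0 < b) (hGb : G * ‖w - u‖ ≤ b)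
    (hs : 0 ≤ s) :
    (Measure.pi fun _ : Fin n => μ).real
        {z | 2 * √(M * ‖w - u‖ ^ 2 * ((∫ y, f w y ∂μ) + ∫ y, f u y ∂μ) * s) + b * s ≤
          generalizationGap μ f z w - generalizationGap μ f z u} ≤
      Real.exp (-(n * s)) := by
  have hint := (hf.integrable w hw).sub (hf.integrable u hu)
  convert measure_integral_sub_average_ge_le (X := fun y => f w y - f u y) hint.aemeasurable hn hb
    (.of_forall fun y => (hf.lipschitz y w hw u hu).trans hGb) (hf.integral_sq_sub_le hw hu) hs
    using 5 with z
  rw [integral_sub (hf.integrable w hw) (hf.integrable u hu), Finset.sum_sub_distrib]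
  unfold generalizationGap
  ring

lemma bernsteinDeviation_of_net (hf : SelfBoundingLoss W μ f G M) {n : ℕ} (hn : 0 < n)
    {z : Fin n → Z} {ε s : ℝ} (hG : 0 ≤ G) (hM : 0 ≤ M) (hs : 0 ≤ s) {T : Set E} (hTW : T ⊆ W)
    (hnet : ∀ w ∈ W, ∃ u ∈ T, ‖w - u‖ ≤ ε)
    (hgap : ∀ w ∈ T, ∀ u ∈ T, generalizationGap μ f z w - generalizationGap μ f z u ≤
      2 * √(M * ‖w - u‖ ^ 2 * ((∫ y, f w y ∂μ) + ∫ y, f u y ∂μ) * s) +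
        G * (‖w - u‖ + ε) * s) :
    BernsteinDeviation W μ f G M ε s z := by
  intro w hw u hu
  obtain ⟨w', hw'T, hww'⟩ := hnet w hw
  obtain ⟨u', hu'T, huu'⟩ := hnet u hu
  have hw' := hTW hw'T
  have hu' := hTW hu'T
  have hdist : ‖w' - u'‖ ≤ ‖w - u‖ + 2 * ε := by
    have heq : w' - u' = w - u - (w - w') + (u - u') := by abel
    rw [heq]
    linarith [norm_add_le (w - u - (w - w')) (u - u'), norm_sub_le (w - u) (w - w')]
  have hGε : ∀ {v v' : E}, ‖v - v'‖ ≤ ε → G * ‖v - v'‖ ≤ G * ε :=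
    fun h => mul_le_mul_of_nonneg_left h hG
  have hintw := abs_le.1 ((hf.abs_integral_sub_le hw hw').trans (hGε hww'))
  have hintu := abs_le.1 ((hf.abs_integral_sub_le hu hu').trans (hGε huu'))
  have hgapw := abs_le.1 (hf.abs_generalizationGap_sub_le hw hw' hn z)
  have hgapu := abs_le.1 (hf.abs_generalizationGap_sub_le hu hu' hn z)
  have hsum : (∫ y, f w' y ∂μ) + ∫ y, f u' y ∂μ ≤
      (∫ y, f w y ∂μ) + (∫ y, f u y ∂μ) + 2 * G * ε := by linarith
  have hsum_nonneg := add_nonneg (hf.integral_nonneg hw') (hf.integral_nonneg hu')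
  have hsqrt : √(M * ‖w' - u'‖ ^ 2 * ((∫ y, f w' y ∂μ) + ∫ y, f u' y ∂μ) * s) ≤
      √(M * (‖w - u‖ + 2 * ε) ^ 2 *
        ((∫ y, f w y ∂μ) + (∫ y, f u y ∂μ) + 2 * G * ε) * s) := by gcongr
  have hlin : G * (‖w' - u'‖ + ε) * s ≤ G * (‖w - u‖ + 3 * ε) * s := by
    gcongr G * ?_ * s; linarith
  linarith [hgap w' hw'T u' hu'T, hGε hww', hGε huu']

lemma exists_measurableSet_bernsteinDeviation (hf : SelfBoundingLoss W μ f G M) {n : ℕ}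
    (hn : 0 < n) {ε s δ : ℝ} (hG : 0 < G) (hM : 0 ≤ M) (hε : 0 < ε) (hs : 0 ≤ s) {T : Finset E}
    (hTW : ↑T ⊆ W) (hnet : ∀ w ∈ W, ∃ u ∈ T, ‖w - u‖ ≤ ε)
    (hcard : (T.card : ℝ) ^ 2 * Real.exp (-(n * s)) ≤ δ) :
    ∃ A, MeasurableSet A ∧ ENNReal.ofReal (1 - δ) ≤ Measure.pi (fun _ : Fin n => μ) A ∧
      ∀ z ∈ A, BernsteinDeviation W μ f G M ε s z := by
  let bad : E × E → Set (Fin n → Z) := fun p =>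
    {z | 2 * √(M * ‖p.1 - p.2‖ ^ 2 * ((∫ y, f p.1 y ∂μ) + ∫ y, f p.2 y ∂μ) * s) +
      G * (‖p.1 - p.2‖ + ε) * s ≤ generalizationGap μ f z p.1 - generalizationGap μ f z p.2}
  have hbad : ∑ p ∈ T ×ˢ T, (Measure.pi fun _ : Fin n => μ).real (bad p) ≤ δ :=
    calc ∑ p ∈ T ×ˢ T, (Measure.pi fun _ : Fin n => μ).real (bad p)
        ≤ ∑ _p ∈ T ×ˢ T, Real.exp (-(n * s)) := Finset.sum_le_sum fun p hp => by
          obtain ⟨hp₁, hp₂⟩ := Finset.mem_product.1 hp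
          exact hf.measure_generalizationGap_sub_ge_le (hTW hp₁) (hTW hp₂) hn (by positivity)
            (by gcongr; linarith) hs
      _ = (T.card : ℝ) ^ 2 * Real.exp (-(n * s)) := by
          rw [Finset.sum_const, Finset.card_product, nsmul_eq_mul, Nat.cast_mul, sq]
      _ ≤ δ := hcard
  obtain ⟨A, hAm, hA, hAbad⟩ := exists_measurableSet_forall_notMem hbad
  exact ⟨A, hAm, hA, fun z hz => hf.bernsteinDeviation_of_net hn hG.le hM hs hTW hnet
    fun w hw u hu => (not_le.1 (hAbad z hz (w, u) (Finset.mk_mem_product hw hu))).le⟩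

end SelfBoundingLoss

end Loss

lemma RiskAssumptions.selfBoundingLoss {d : ℕ} {Z : Type*} [MeasurableSpace Z]
    {R G G' L ρ θ α : ℝ} {W : Set (Vec d)} {μ : Measure Z} {f : Vec d → Z → ℝ} {r : Vec d → ℝ}
    (hA : RiskAssumptions R G G' L ρ θ α W μ f r) (hG : 0 < G) (hL : 0 ≤ L) (hρ : 0 < ρ) :
    SelfBoundingLoss W μ f G (2 * (L + 2 * G / ρ)) := by
  have hnonneg : ∀ z, ∀ w ∈ W, 0 ≤ f w z := fun z w hw =>
    (hA.smooth_loss z).1 w (self_subset_thickening hρ W hw)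
  refine ⟨hA.integrable, hnonneg, hA.lipschitz_loss, fun z w hw u hu => ?_⟩
  obtain ⟨hpos, -, hsmooth⟩ := hA.smooth_loss z
  wlog hle : f u z ≤ f w z generalizing w u
  · rw [← neg_sub, neg_sq, norm_sub_rev, add_comm (f w z)]
    exact this u hu w hw (le_of_not_ge hle)
  have hball : ball w ρ ⊆ thickening ρ W := ball_subset_thickening hw ρ
  have hww := hball (mem_ball_self hρ)
  calc (f w z - f u z) ^ 2 ≤ 2 * (L + 2 * G / ρ) * ‖w - u‖ ^ 2 * f w z :=
        sq_sub_le_of_le_of_quadratic_upper_bound (g := fun v => f v z)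
          (p := innerₛₗ ℝ (gradient (fun v => f v z) w)) hG hL hρ (fun v hv => hpos v (hball hv))
          (fun v hv => by
            rw [innerₛₗ_apply_apply]; linarith [(hsmooth v (hball hv) w hww).2])
          (by
            rw [innerₛₗ_apply_apply]
            linarith [(hsmooth u (self_subset_thickening hρ W hu) w hww).1])
          ((le_abs_self _).trans (hA.lipschitz_loss z w hw u hu)) hle
    _ ≤ 2 * (L + 2 * G / ρ) * ‖w - u‖ ^ 2 * (f w z + f u z) := by
        gcongr
        exact le_add_of_nonneg_right (hnonneg z u hu)

section Complexity

lemma half_le_log_natCast {n : ℕ} (hn : 2 ≤ n) : 1 / 2 ≤ Real.log n := by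
  have hlog : Real.log 2 ≤ Real.log n := Real.log_le_log two_pos (by exact_mod_cast hn)
  linarith [Real.log_two_gt_d9]

variable {d n : ℕ} {δ : ℝ}

lemma mul_log_le_complexity (hδ : 0 < δ) (hδ1 : δ < 1) :
    d * Real.log n ≤ complexity d n δ :=
  le_add_of_nonneg_right (Real.log_nonneg ((one_le_div hδ).2 hδ1.le))

lemma complexity_pos (hδ : 0 < δ) (hδ1 : δ < 1) : 0 < complexity d n δ :=
  add_pos_of_nonneg_of_pos (mul_nonneg d.cast_nonneg (Real.log_natCast_nonneg n))
    (Real.log_pos ((one_lt_div hδ).2 hδ1))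

lemma sq_mul_exp_neg_complexity_le {R : ℝ} {N : ℕ} (hR : 0 ≤ R) (hn : 2 ≤ n) (hδ : 0 < δ)
    (hδ1 : δ < 1) (hN : (N : ℝ) ≤ (2 * R / (1 / (n : ℝ) ^ 2) + 1) ^ d) :
    (N : ℝ) ^ 2 * Real.exp (-((4 + 8 * R) * complexity d n δ)) ≤ δ := by
  have hn0 : (0 : ℝ) < n := by positivity
  have hlog := half_le_log_natCast hn
  have hbase : 2 * R / (1 / (n : ℝ) ^ 2) + 1 ≤ Real.exp ((2 + 4 * R) * Real.log n) := by
    have hsq : Real.exp (2 * Real.log n) = (n : ℝ) ^ 2 := by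
      rw [mul_comm, Real.exp_mul, Real.exp_log hn0, Real.rpow_two]
    have hone : (1 : ℝ) ≤ (n : ℝ) ^ 2 := one_le_pow₀ (by exact_mod_cast (by omega : 1 ≤ n))
    calc 2 * R / (1 / (n : ℝ) ^ 2) + 1 = n ^ 2 * (2 * R) + 1 := by
          rw [div_div_eq_mul_div, div_one, mul_comm]
      _ ≤ n ^ 2 * (4 * R * Real.log n + 1) := by nlinarith [mul_nonneg hR (sub_nonneg.2 hlog)]
      _ ≤ n ^ 2 * Real.exp (4 * R * Real.log n) := by gcongr; exact Real.add_one_le_exp _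
      _ = Real.exp ((2 + 4 * R) * Real.log n) := by rw [← hsq, ← Real.exp_add]; ring_nf
  have hNexp : (N : ℝ) ≤ Real.exp (d * ((2 + 4 * R) * Real.log n)) := by
    rw [Real.exp_nat_mul]
    exact hN.trans (by gcongr)
  have hlogδ : 0 ≤ Real.log (1 / δ) := Real.log_nonneg ((one_le_div hδ).2 hδ1.le)
  calc (N : ℝ) ^ 2 * Real.exp (-((4 + 8 * R) * complexity d n δ))
      ≤ Real.exp (d * ((2 + 4 * R) * Real.log n)) ^ 2 *
          Real.exp (-((4 + 8 * R) * complexity d n δ)) := by gcongr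
    _ = Real.exp (-((4 + 8 * R) * Real.log (1 / δ))) := by
        rw [← Real.exp_nat_mul, ← Real.exp_add, complexity]
        push_cast
        ring_nf
    _ ≤ Real.exp (-Real.log (1 / δ)) := by gcongr; nlinarith
    _ = δ := by rw [Real.exp_neg, Real.exp_log (by positivity), one_div, inv_inv]

lemma SelfBoundingLoss.exists_measurableSet_bernsteinDeviation_complexity {Z : Type*}
    [MeasurableSpace Z] {μ : Measure Z} [IsProbabilityMeasure μ] {W : Set (Vec d)}
    {f : Vec d → Z → ℝ} {G M R : ℝ} (hf : SelfBoundingLoss W μ f G M) (hG : 0 < G) (hM : 0 ≤ M)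
    (hR : 0 ≤ R) (hW : ∀ w ∈ W, ‖w‖ ≤ R) (hn : 2 ≤ n) (hδ : 0 < δ) (hδ1 : δ < 1) :
    ∃ A, MeasurableSet A ∧ ENNReal.ofReal (1 - δ) ≤ Measure.pi (fun _ : Fin n => μ) A ∧
      ∀ z ∈ A, BernsteinDeviation W μ f G M (1 / (n : ℝ) ^ 2)
        ((4 + 8 * R) * (complexity d n δ / n)) z := by
  have hε : (0 : ℝ) < 1 / (n : ℝ) ^ 2 := by positivity
  have hC := complexity_pos (d := d) (n := n) hδ hδ1
  obtain ⟨T, hTW, hTcard, hnet⟩ := exists_finset_net_of_norm_le hR hε hW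
  rw [finrank_euclideanSpace_fin] at hTcard
  refine hf.exists_measurableSet_bernsteinDeviation (by omega) hG hM hε (by positivity) hTW hnet ?_
  rw [mul_left_comm, mul_div_cancel₀ _ (by positivity)]
  exact sq_mul_exp_neg_complexity_le hR hn hδ hδ1 hTcard

end Complexity

section Rates

lemma two_mul_sqrt_mul_add_le {a p q : ℝ} (ha : 0 ≤ a) (hp : 0 ≤ p) (hq : 0 ≤ q) :
    2 * √(a * (2 * p + q)) ≤ 4 * √(a * p) + 2 * a + q / 2 := by
  have hap : 0 ≤ a * p := mul_nonneg ha hp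
  have hsqrt : √(a * (2 * p + q)) ≤ 2 * √(a * p) + (a + q / 4) := by
    refine Real.sqrt_le_iff.2 ⟨by positivity, ?_⟩
    have hcross : 0 ≤ √(a * p) * (a + q / 4) := by positivity
    nlinarith [Real.sq_sqrt hap, sq_nonneg (a - q / 4)]
  linarith

lemma le_of_le_bernstein {G N k R Δ P ε x D : ℝ} (hG : 0 ≤ G) (hN : 0 ≤ N) (hk : 0 ≤ k)
    (hΔ : 0 ≤ Δ) (hP : 0 ≤ P) (hε : 0 ≤ ε) (hε1 : ε ≤ 1) (hx : 0 ≤ x) (hx1 : x ≤ 1)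
    (hxP : x * P ≤ 1) (hD : 0 ≤ D) (hDR : D ≤ 2 * R)
    (h : Δ ≤ 4 * G * ε + 2 * √(N * (D + 2 * ε) ^ 2 * (2 * P + Δ + 2 * G * ε) * x) +
      G * (D + 3 * ε) * (k * x)) :
    Δ ≤ (10 * G + 16 * √N + 16 * N * (R + 1) + 6 * G * k) * (ε + D * x + D * √(x * P)) := by
  set y := √(x * P)
  set S := ε + D * x + D * y
  have hy1 : y ≤ 1 := Real.sqrt_le_one.2 hxP
  have hDx : 0 ≤ D * x := by positivity
  have hDy : 0 ≤ D * y := by positivity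
  have hεx : ε * x ≤ ε := mul_le_of_le_one_right hε hx1
  have hεy : ε * y ≤ ε := mul_le_of_le_one_right hε hy1
  have hεS : ε ≤ S := by linarith
  have hEx : (D + 2 * ε) * x ≤ 2 * S := by linarith
  have hEy : (D + 2 * ε) * y ≤ 2 * S := by linarith
  have hFx : (D + 3 * ε) * x ≤ 3 * S := by linarith
  have hsqrt : 2 * √(N * (D + 2 * ε) ^ 2 * (2 * P + Δ + 2 * G * ε) * x) ≤
      4 * (√N * ((D + 2 * ε) * y)) + 2 * (N * ((D + 2 * ε) ^ 2 * x)) + (Δ + 2 * G * ε) / 2 := by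
    have hyP : √(N * ((D + 2 * ε) ^ 2 * x) * P) = √N * ((D + 2 * ε) * y) := by
      rw [mul_assoc, mul_assoc, Real.sqrt_mul hN, Real.sqrt_mul (sq_nonneg _),
        Real.sqrt_sq (by positivity)]
    rw [← hyP]
    convert two_mul_sqrt_mul_add_le (a := N * ((D + 2 * ε) ^ 2 * x)) (q := Δ + 2 * G * ε)
      (by positivity) hP (by positivity) using 3
    ring
  have hsq : (D + 2 * ε) ^ 2 * x ≤ 2 * (R + 1) * (2 * S) :=
    calc (D + 2 * ε) ^ 2 * x = (D + 2 * ε) * ((D + 2 * ε) * x) := by ring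
      _ ≤ 2 * (R + 1) * (2 * S) := mul_le_mul (by linarith) hEx (by positivity) (by linarith)
  linarith [mul_le_mul_of_nonneg_left hsq hN,
    mul_le_mul_of_nonneg_left hEy (Real.sqrt_nonneg N), mul_le_mul_of_nonneg_left hεS hG,
    mul_le_mul_of_nonneg_left hFx (mul_nonneg hG hk)]

lemma le_sq_mul_max_mul_rpow {Δ D k s θ α : ℝ} (hθ : 0 < θ) (hθ1 : θ ≤ 1) (hα : 0 < α)
    (hΔ : 0 ≤ Δ) (hk : 1 ≤ k) (hs : 0 ≤ s) (hD : D ^ 2 ≤ α * Δ ^ θ) (h : Δ ≤ k * (D * √s)) :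
    Δ ≤ k ^ 2 * (max 1 (α ^ (1 / θ)) * s ^ (1 / (2 - θ))) := by
  have h2θ : 0 < 2 - θ := by linarith
  have hexp : 1 / (2 - θ) ≤ 1 := (div_le_one h2θ).2 (by linarith)
  rcases hΔ.eq_or_lt with rfl | hpos
  · positivity
  have hself : Δ ^ (2 - θ) ≤ k ^ 2 * s * α := by
    refine le_of_mul_le_mul_right ?_ (Real.rpow_pos_of_pos hpos θ)
    calc Δ ^ (2 - θ) * Δ ^ θ = Δ ^ 2 := by
          rw [← Real.rpow_add hpos, sub_add_cancel, Real.rpow_two]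
      _ ≤ (k * (D * √s)) ^ 2 := by gcongr
      _ = k ^ 2 * s * D ^ 2 := by rw [mul_pow, mul_pow, Real.sq_sqrt hs]; ring
      _ ≤ k ^ 2 * s * (α * Δ ^ θ) := by gcongr
      _ = k ^ 2 * s * α * Δ ^ θ := by ring
  have hkpow : (k ^ 2) ^ (1 / (2 - θ)) ≤ k ^ 2 :=
    Real.rpow_le_self_of_one_le (one_le_pow₀ hk) hexp
  have hαpow : α ^ (1 / (2 - θ)) ≤ max 1 (α ^ (1 / θ)) := by
    rcases le_total α 1 with hα1 | hα1
    · exact le_max_of_le_left (Real.rpow_le_one hα.le hα1 (by positivity))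
    · refine le_max_of_le_right (Real.rpow_le_rpow_of_exponent_le hα1 ?_)
      gcongr
      linarith
  calc Δ = (Δ ^ (2 - θ)) ^ (1 / (2 - θ)) := by
        rw [← Real.rpow_mul hΔ, mul_one_div_cancel h2θ.ne', Real.rpow_one]
    _ ≤ (k ^ 2 * s * α) ^ (1 / (2 - θ)) := by gcongr
    _ = (k ^ 2) ^ (1 / (2 - θ)) * (α ^ (1 / (2 - θ)) * s ^ (1 / (2 - θ))) := by
        rw [Real.mul_rpow (by positivity) hα.le, Real.mul_rpow (by positivity) hs]; ring
    _ ≤ k ^ 2 * (max 1 (α ^ (1 / θ)) * s ^ (1 / (2 - θ))) := by gcongr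

/-- The excess risk rate at relative complexity `x` (that is, `C / n`) and optimal risk `P` under
the error bound condition with parameters `θ` and `α`. Its two possible minima are the slow and
the fast rate. -/
noncomputable def excessRate (θ α x P : ℝ) : ℝ :=
  min x (max 1 (α ^ (1 / θ)) * x ^ (2 / (2 - θ))) +
    max 1 (α ^ (1 / θ)) * (x * P) ^ (1 / (2 - θ))

lemma excessRate_nonneg {θ α x P : ℝ} (hx : 0 ≤ x) (hP : 0 ≤ P) :
    0 ≤ excessRate θ α x P := by
  unfold excessRate
  positivity

lemma sq_le_min_max_mul_rpow {θ α x : ℝ} (hθ1 : θ ≤ 1) (hx : 0 < x) (hx1 : x ≤ 1) :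
    x ^ 2 ≤ min x (max 1 (α ^ (1 / θ)) * x ^ (2 / (2 - θ))) := by
  refine le_min (pow_le_of_le_one hx.le hx1 two_ne_zero) ?_
  calc x ^ 2 = x ^ (2 : ℝ) := (Real.rpow_two x).symm
    _ ≤ x ^ (2 / (2 - θ)) :=
      Real.rpow_le_rpow_of_exponent_ge hx hx1 (div_le_self zero_le_two (by linarith))
    _ ≤ max 1 (α ^ (1 / θ)) * x ^ (2 / (2 - θ)) :=
      le_mul_of_one_le_left (by positivity) (le_max_left _ _)

lemma quarter_le_excessRate {θ α x P : ℝ} (hθ1 : θ ≤ 1) (hx : 0 < x) (hP : 0 ≤ P)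
    (h : 1 / 2 ≤ x ∨ 1 ≤ x * P) : 1 / 4 ≤ excessRate θ α x P := by
  have h2θ : 0 < 2 - θ := by linarith
  unfold excessRate
  rcases h with hx2 | hxP
  · refine le_add_of_le_of_nonneg (le_min (by linarith) ?_) (by positivity)
    calc (1 / 4 : ℝ) = (1 / 2) ^ 2 := by norm_num
      _ ≤ max 1 (α ^ (1 / θ)) * (1 / 2) ^ (2 / (2 - θ)) :=
        (sq_le_min_max_mul_rpow hθ1 (by norm_num) (by norm_num)).trans (min_le_right _ _)
      _ ≤ max 1 (α ^ (1 / θ)) * x ^ (2 / (2 - θ)) := by gcongr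
  · refine le_add_of_nonneg_of_le (by positivity) ?_
    calc (1 / 4 : ℝ) ≤ 1 * 1 := by norm_num
      _ ≤ max 1 (α ^ (1 / θ)) * (x * P) ^ (1 / (2 - θ)) :=
        mul_le_mul (le_max_left _ _) (Real.one_le_rpow hxP (by positivity)) zero_le_one
          (by positivity)

lemma le_mul_excessRate {θ α x P Δ D R k ε : ℝ} (hθ : 0 < θ) (hθ1 : θ ≤ 1) (hα : 0 < α)
    (hk : 1 ≤ k) (hx : 0 < x) (hx1 : x ≤ 1) (hP : 0 ≤ P) (hεx : ε ≤ 4 * x ^ 2) (hΔ : 0 ≤ Δ)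
    (hD : 0 ≤ D) (hDR : D ≤ 2 * R) (hDΔ : D ^ 2 ≤ α * Δ ^ θ)
    (h : Δ ≤ k * (ε + D * x + D * √(x * P))) :
    Δ ≤ (12 * k + 6 * k * R + 9 * k ^ 2) * excessRate θ α x P := by
  have hR : 0 ≤ R := by linarith
  have hxP : 0 ≤ x * P := by positivity
  set K := 12 * k + 6 * k * R + 9 * k ^ 2
  set m := max 1 (α ^ (1 / θ))
  have hK : 0 ≤ K := by positivity
  have hk₁ : 12 * k ≤ K := by linarith [show 0 ≤ 6 * k * R + 9 * k ^ 2 by positivity]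
  have hk₂ : 6 * k * R ≤ K := by linarith [show 0 ≤ 12 * k + 9 * k ^ 2 by positivity]
  have hk₃ : (3 * k) ^ 2 ≤ K := by linarith [show 0 ≤ 12 * k + 6 * k * R by positivity]
  have hmin : 0 ≤ min x (m * x ^ (2 / (2 - θ))) := by positivity
  have hrpow : 0 ≤ m * (x * P) ^ (1 / (2 - θ)) := by positivity
  have hcases : Δ ≤ 3 * k * ε ∨ Δ ≤ 3 * k * (D * x) ∨ Δ ≤ 3 * k * (D * √(x * P)) := by
    by_contra! hlt
    linarith [hlt.1, hlt.2.1, hlt.2.2]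
  unfold excessRate
  rcases hcases with hΔε | hΔx | hΔP
  · calc Δ ≤ 3 * k * (4 * x ^ 2) := hΔε.trans (by gcongr)
      _ = 12 * k * x ^ 2 := by ring
      _ ≤ K * min x (m * x ^ (2 / (2 - θ))) := by
        gcongr; exact sq_le_min_max_mul_rpow hθ1 hx hx1
      _ ≤ K * _ := by gcongr; exact le_add_of_nonneg_right hrpow
  · have hslow : Δ ≤ K * x :=
      calc Δ ≤ 3 * k * (2 * R * x) := hΔx.trans (by gcongr)
        _ = 6 * k * R * x := by ring
        _ ≤ K * x := by gcongr
    have hfast : Δ ≤ K * (m * x ^ (2 / (2 - θ))) := by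
      have hsolve := le_sq_mul_max_mul_rpow (k := 3 * k) (s := x ^ 2) hθ hθ1 hα hΔ (by linarith)
        (sq_nonneg x) hDΔ (by rwa [Real.sqrt_sq hx.le])
      rw [← Real.rpow_two x, ← Real.rpow_mul hx.le, mul_one_div] at hsolve
      exact hsolve.trans (by gcongr)
    calc Δ ≤ K * min x (m * x ^ (2 / (2 - θ))) := by
          rw [mul_min_of_nonneg _ _ hK]; exact le_min hslow hfast
      _ ≤ K * _ := by gcongr; exact le_add_of_nonneg_right hrpow
  · calc Δ ≤ (3 * k) ^ 2 * (m * (x * P) ^ (1 / (2 - θ))) :=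
          le_sq_mul_max_mul_rpow hθ hθ1 hα hΔ (by linarith) hxP hDΔ hΔP
      _ ≤ K * (m * (x * P) ^ (1 / (2 - θ))) := by gcongr
      _ ≤ K * _ := by gcongr; exact le_add_of_nonneg_left hmin

end Rates

section EmpiricalRiskMinimization

variable {d n : ℕ} {Z : Type*} [MeasurableSpace Z] {μ : Measure Z} {W : Set (Vec d)}
  {f : Vec d → Z → ℝ} {r : Vec d → ℝ} {R G G' M θ α δ : ℝ}

lemma exists_closest_argminOn {φ : Vec d → ℝ} {w : Vec d} (hW : IsCompact W)
    (hφ : ContinuousOn φ W) (hw : w ∈ W) :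
    ∃ u ∈ argminOn W φ, (∀ v ∈ argminOn W φ, ‖u - w‖ ≤ ‖v - w‖) ∧ optValue W φ = φ u := by
  obtain ⟨v, hv, hvmin⟩ := hW.exists_isMinOn ⟨w, hw⟩ hφ
  have hargmin : argminOn W φ = W ∩ φ ⁻¹' Set.Iic (φ v) :=
    Set.ext fun u => ⟨fun h => ⟨h.1, h.2 v hv⟩, fun h => ⟨h.1, fun y hy => h.2.trans (hvmin hy)⟩⟩
  have hcompact : IsCompact (argminOn W φ) := by
    rw [hargmin]
    exact hW.of_isClosed_subset (hφ.preimage_isClosed_of_isClosed hW.isClosed isClosed_Iic)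
      Set.inter_subset_left
  obtain ⟨u, hu, hclosest⟩ := hcompact.exists_isMinOn (f := fun u => ‖u - w‖)
    ⟨v, hv, fun y hy => hvmin hy⟩ (by fun_prop)
  have hleast : IsLeast (φ '' W) (φ u) :=
    ⟨Set.mem_image_of_mem φ hu.1, Set.forall_mem_image.2 fun y hy => hu.2 y hy⟩
  exact ⟨u, hu, fun v hv => hclosest hv, hleast.csInf_eq⟩

lemma LipschitzBoundOn.continuousOn {φ : Vec d → ℝ} (hφ : LipschitzBoundOn W G φ) :
    ContinuousOn φ W :=
  (LipschitzOnWith.of_dist_le' fun w hw u hu => by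
    rw [Real.dist_eq, dist_eq_norm]; exact hφ w hw u hu).continuousOn

lemma SelfBoundingLoss.lipschitzBoundOn_risk [IsProbabilityMeasure μ]
    (hf : SelfBoundingLoss W μ f G M) (hr : LipschitzBoundOn W G' r) :
    LipschitzBoundOn W (G + G') (risk μ f r) := by
  intro w hw u hu
  have hloss := abs_le.1 (hf.abs_integral_sub_le hw hu)
  have hreg := abs_le.1 (hr w hw u hu)
  unfold risk
  exact abs_le.2 ⟨by linarith, by linarith⟩

lemma risk_sub_le_generalizationGap_sub {z : Fin n → Z} {w u : Vec d}
    (hw : w ∈ argminOn W (empRisk f r z)) (hu : u ∈ W) :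
    risk μ f r w - risk μ f r u ≤ generalizationGap μ f z w - generalizationGap μ f z u := by
  have hmin := hw.2 u hu
  unfold empRisk at hmin
  unfold risk generalizationGap
  linarith

/-- The constant in front of the fixed-point inequality for the excess risk, obtained from
Bernstein's inequality at deviation level `(4 + 8 * R) * C / n`. The summand `1` only serves to
keep it at least one. -/
noncomputable def bernsteinConstant (R G M : ℝ) : ℝ :=
  10 * G + 16 * √(M * (4 + 8 * R)) + 16 * (M * (4 + 8 * R)) * (R + 1) + 6 * G * (4 + 8 * R) + 1

lemma one_le_bernsteinConstant (hR : 0 ≤ R) (hG : 0 ≤ G) (hM : 0 ≤ M) :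
    1 ≤ bernsteinConstant R G M :=
  le_add_of_nonneg_left (by positivity)

lemma BernsteinDeviation.risk_sub_le {ε x : ℝ} {z : Fin n → Z} {w u : Vec d}
    (hz : BernsteinDeviation W μ f G M ε ((4 + 8 * R) * x) z) (hf : SelfBoundingLoss W μ f G M)
    (hr : ∀ w ∈ W, 0 ≤ r w) (hW : ∀ w ∈ W, ‖w‖ ≤ R) (hG : 0 ≤ G) (hM : 0 ≤ M)
    (hε : 0 ≤ ε) (hε1 : ε ≤ 1) (hx : 0 ≤ x) (hx1 : x ≤ 1) (hxP : x * risk μ f r u ≤ 1)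
    (hw : w ∈ argminOn W (empRisk f r z)) (hu : u ∈ argminOn W (risk μ f r)) :
    risk μ f r w - risk μ f r u ≤
      bernsteinConstant R G M * (ε + ‖w - u‖ * x + ‖w - u‖ * √(x * risk μ f r u)) := by
  have hR : 0 ≤ R := (norm_nonneg w).trans (hW w hw.1)
  have hP : 0 ≤ risk μ f r u := add_nonneg (hf.integral_nonneg hu.1) (hr u hu.1)
  have hsum : (∫ y, f w y ∂μ) + ∫ y, f u y ∂μ ≤
      2 * risk μ f r u + (risk μ f r w - risk μ f r u) := by
    unfold risk
    linarith [hr w hw.1, hr u hu.1]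
  have hdiam : ‖w - u‖ ≤ 2 * R := by
    linarith [norm_sub_le w u, hW w hw.1, hW u hu.1]
  refine (le_of_le_bernstein (N := M * (4 + 8 * R)) (k := 4 + 8 * R) hG (by positivity)
    (by positivity) (sub_nonneg.2 (hu.2 w hw.1)) hP hε hε1 hx hx1 hxP (norm_nonneg _) hdiam
    ?_).trans (mul_le_mul_of_nonneg_right (le_add_of_nonneg_right zero_le_one)
    (by positivity))
  calc risk μ f r w - risk μ f r u
      ≤ 4 * G * ε + 2 * √(M * (‖w - u‖ + 2 * ε) ^ 2 *
          ((∫ y, f w y ∂μ) + (∫ y, f u y ∂μ) + 2 * G * ε) * ((4 + 8 * R) * x)) +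
          G * (‖w - u‖ + 3 * ε) * ((4 + 8 * R) * x) :=
        (risk_sub_le_generalizationGap_sub hw hu.1).trans (hz w hw.1 u hu.1)
    _ ≤ 4 * G * ε + 2 * √(M * (‖w - u‖ + 2 * ε) ^ 2 *
          (2 * risk μ f r u + (risk μ f r w - risk μ f r u) + 2 * G * ε) * ((4 + 8 * R) * x)) +
          G * (‖w - u‖ + 3 * ε) * ((4 + 8 * R) * x) := by gcongr
    _ = _ := by ring_nf

lemma one_div_sq_le_complexity (hd : d ≠ 0) (hn : 2 ≤ n) (hδ : 0 < δ) (hδ1 : δ < 1) :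
    1 / (n : ℝ) ^ 2 ≤ 4 * (complexity d n δ / n) ^ 2 := by
  have hC : 1 / 2 ≤ complexity d n δ :=
    calc (1 / 2 : ℝ) ≤ Real.log n := half_le_log_natCast hn
      _ ≤ d * Real.log n := le_mul_of_one_le_left (Real.log_natCast_nonneg n)
        (by exact_mod_cast Nat.one_le_iff_ne_zero.2 hd)
      _ ≤ complexity d n δ := mul_log_le_complexity hδ hδ1
  calc 1 / (n : ℝ) ^ 2 = 4 * ((1 / 2) / n) ^ 2 := by ring
    _ ≤ 4 * (complexity d n δ / n) ^ 2 := by gcongr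

/-- The constant in front of the excess risk rate. The summand with the factor `8 * R` covers the
regime where the rate exceeds `1 / 4` and the Lipschitz bound on the risk suffices. -/
noncomputable def rateConstant (R G G' M : ℝ) : ℝ :=
  8 * R * (G + G') + (12 * bernsteinConstant R G M + 6 * bernsteinConstant R G M * R +
    9 * bernsteinConstant R G M ^ 2)

lemma rateConstant_pos (hR : 0 ≤ R) (hG : 0 ≤ G) (hG' : 0 ≤ G') (hM : 0 ≤ M) :
    0 < rateConstant R G G' M := by
  have := one_le_bernsteinConstant hR hG hM
  unfold rateConstant
  positivity

lemma BernsteinDeviation.risk_sub_le_mul_excessRate [IsProbabilityMeasure μ] {z : Fin n → Z}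
    {w u : Vec d}
    (hz : BernsteinDeviation W μ f G M (1 / (n : ℝ) ^ 2) ((4 + 8 * R) * (complexity d n δ / n)) z)
    (hf : SelfBoundingLoss W μ f G M) (hr : ∀ w ∈ W, 0 ≤ r w) (hrG : LipschitzBoundOn W G' r)
    (hW : ∀ w ∈ W, ‖w‖ ≤ R) (hθ : 0 < θ) (hθ1 : θ ≤ 1) (hα : 0 < α) (hn : 2 ≤ n) (hδ : 0 < δ)
    (hδ1 : δ < 1) (hG : 0 ≤ G) (hG' : 0 ≤ G') (hM : 0 ≤ M)
    (hw : w ∈ argminOn W (empRisk f r z)) (hu : u ∈ argminOn W (risk μ f r))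
    (hwu : ‖w - u‖ ^ 2 ≤ α * (risk μ f r w - risk μ f r u) ^ θ) :
    risk μ f r w - risk μ f r u ≤
      rateConstant R G G' M * excessRate θ α (complexity d n δ / n) (risk μ f r u) := by
  have hR : 0 ≤ R := (norm_nonneg w).trans (hW w hw.1)
  have hx : 0 < complexity d n δ / n := div_pos (complexity_pos hδ hδ1) (by positivity)
  have hP : 0 ≤ risk μ f r u := add_nonneg (hf.integral_nonneg hu.1) (hr u hu.1)
  have hk := one_le_bernsteinConstant hR hG hM
  have hdiam : ‖w - u‖ ≤ 2 * R := by linarith [norm_sub_le w u, hW w hw.1, hW u hu.1]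
  have hΔ : 0 ≤ risk μ f r w - risk μ f r u := sub_nonneg.2 (hu.2 w hw.1)
  set x := complexity d n δ / n
  set P := risk μ f r u
  have hrate : 0 ≤ excessRate θ α x P := excessRate_nonneg hx.le hP
  rw [rateConstant, add_mul]
  by_cases hlarge : 1 / 2 ≤ x ∨ 1 ≤ x * P
  · have hquarter := quarter_le_excessRate (α := α) hθ1 hx hP hlarge
    refine le_add_of_le_of_nonneg ?_ (by positivity)
    calc risk μ f r w - P ≤ (G + G') * ‖w - u‖ :=
          (le_abs_self _).trans (hf.lipschitzBoundOn_risk hrG w hw.1 u hu.1)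
      _ ≤ (G + G') * (2 * R) := by gcongr
      _ = 8 * R * (G + G') * (1 / 4) := by ring
      _ ≤ 8 * R * (G + G') * excessRate θ α x P := by gcongr
  · obtain ⟨hx2, hxP⟩ := not_or.1 hlarge
    refine le_add_of_nonneg_of_le (by positivity) ?_
    rcases eq_or_ne d 0 with rfl | hd
    · rw [Subsingleton.elim w u, sub_self]
      positivity
    have hε1 : 1 / (n : ℝ) ^ 2 ≤ 1 :=
      div_le_one_of_le₀ (one_le_pow₀ (by exact_mod_cast (by omega : 1 ≤ n))) (by positivity)
    exact le_mul_excessRate hθ hθ1 hα hk hx (by linarith) hP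
      (one_div_sq_le_complexity hd hn hδ hδ1) hΔ (norm_nonneg _) hdiam hwu
      (hz.risk_sub_le hf hr hW hG hM (by positivity) hε1 hx.le (by linarith) (by linarith)
        hw hu)

theorem SelfBoundingLoss.ermBound_excessRate [IsProbabilityMeasure μ]
    (hf : SelfBoundingLoss W μ f G M) (hWc : IsClosed W) (hW : ∀ w ∈ W, ‖w‖ ≤ R)
    (hr : ∀ w ∈ W, 0 ≤ r w) (hrG : LipschitzBoundOn W G' r)
    (herr : ErrorBoundCondition W (risk μ f r) θ α) (hθ : 0 < θ) (hθ1 : θ ≤ 1) (hα : 0 < α)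
    (hn : 2 ≤ n) (hδ : 0 < δ) (hδ1 : δ < 1) (hR : 0 ≤ R) (hG : 0 < G) (hG' : 0 ≤ G')
    (hM : 0 ≤ M) :
    ERMBound n δ W μ f r (rateConstant R G G' M *
      excessRate θ α (complexity d n δ / n) (optValue W (risk μ f r))) := by
  have hcompact : IsCompact W := Metric.isCompact_of_isClosed_isBounded hWc
    (isBounded_iff_forall_norm_le.2 ⟨R, hW⟩)
  obtain ⟨A, hAm, hA, hdev⟩ :=
    hf.exists_measurableSet_bernsteinDeviation_complexity hG hM hR hW hn hδ hδ1
  refine ⟨A, hAm, hA, fun z hz w hw => ?_⟩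
  obtain ⟨u, hu, hclosest, hopt⟩ :=
    exists_closest_argminOn hcompact (hf.lipschitzBoundOn_risk hrG).continuousOn hw.1
  rw [hopt]
  exact (hdev z hz).risk_sub_le_mul_excessRate hf hr hrG hW hθ hθ1 hα hn hδ hδ1 hG.le hG' hM hw hu
    (herr w hw.1 u hu hclosest)

lemma ERMBound.mono {B B' : ℝ} (h : ERMBound n δ W μ f r B) (hB : B ≤ B') :
    ERMBound n δ W μ f r B' :=
  let ⟨A, hAm, hA, hbound⟩ := h
  ⟨A, hAm, hA, fun z hz w hw => (hbound z hz w hw).trans hB⟩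

end EmpiricalRiskMinimization

theorem theorem2_general (R G G' M : ℝ) (hR : 0 ≤ R) (hG : 0 < G) (hG' : 0 ≤ G') (hM : 0 ≤ M) :
    ∃ K : ℝ, 0 < K ∧
      ∀ (d n : ℕ) (θ α δ : ℝ) {Z : Type*} [MeasurableSpace Z] (μ : Measure Z)
        [IsProbabilityMeasure μ] (W : Set (Vec d)) (f : Vec d → Z → ℝ) (r : Vec d → ℝ),
        0 < θ → θ ≤ 1 → 0 < α → 2 ≤ n → 0 < δ → δ < 1 →
        IsClosed W → (∀ w ∈ W, ‖w‖ ≤ R) → SelfBoundingLoss W μ f G M →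
        (∀ w ∈ W, 0 ≤ r w) → LipschitzBoundOn W G' r →
        ErrorBoundCondition W (risk μ f r) θ α →
        ERMBound n δ W μ f r
          (K * (complexity d n δ / n + max 1 (α ^ (1 / θ)) *
            (complexity d n δ * optValue W (risk μ f r) / n) ^ (1 / (2 - θ)))) ∧
        ERMBound n δ W μ f r
          (K * max 1 (α ^ (1 / θ)) * ((complexity d n δ / n) ^ (2 / (2 - θ)) +
            (complexity d n δ * optValue W (risk μ f r) / n) ^ (1 / (2 - θ)))) := by
  have hK := rateConstant_pos hR hG.le hG' hM
  refine ⟨_, hK, fun d n θ α δ Z _ μ _ W f r hθ hθ1 hα hn hδ hδ1 hWc hW hf hr hrG herr => ?_⟩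
  have hrate := hf.ermBound_excessRate hWc hW hr hrG herr hθ hθ1 hα hn hδ hδ1 hR hG hG' hM
  rw [mul_div_right_comm, mul_assoc _ (max 1 _), mul_add (max 1 _)]
  exact ⟨hrate.mono (by unfold excessRate; gcongr; exact min_le_left _ _),
    hrate.mono (by unfold excessRate; gcongr; exact min_le_right _ _)⟩

theorem theorem2 (R G G' L ρ : ℝ) (hR : 0 < R) (hG : 0 < G) (hG' : 0 ≤ G') (hL : 0 ≤ L)
    (hρ : 0 < ρ) :
    ∃ c K : ℝ, 0 < c ∧ 0 < K ∧
      ∀ (d n : ℕ) (θ α δ : ℝ) {Z : Type*} [MeasurableSpace Z] (μ : Measure Z)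
        [IsProbabilityMeasure μ] (W : Set (Vec d)) (f : Vec d → Z → ℝ) (r : Vec d → ℝ),
        0 < θ → θ ≤ 1 → 0 < α → 2 ≤ n → 0 < δ → δ < 1 →
        RiskAssumptions R G G' L ρ θ α W μ f r →
        ERMBound n δ W μ f r
          (K * (complexity d n δ / n + max 1 (α ^ (1 / θ)) *
            (complexity d n δ * optValue W (risk μ f r) / n) ^ (1 / (2 - θ)))) ∧
        (c * (α ^ (1 / θ) * ((d : ℝ) * Real.log n)) ^ (2 - θ) ≤ (n : ℝ) →
          ERMBound n δ W μ f r
            (K * max 1 (α ^ (1 / θ)) * ((complexity d n δ / n) ^ (2 / (2 - θ)) +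
              (complexity d n δ * optValue W (risk μ f r) / n) ^ (1 / (2 - θ))))) := by
  have hM : 0 ≤ 2 * (L + 2 * G / ρ) := by positivity
  obtain ⟨K, hK, hbound⟩ := theorem2_general R G G' (2 * (L + 2 * G / ρ)) hR.le hG hG' hM
  refine ⟨1, K, one_pos, hK, fun d n θ α δ Z _ μ _ W f r hθ hθ1 hα hn hδ hδ1 hA => ?_⟩
  exact (hbound d n θ α δ μ W f r hθ hθ1 hα hn hδ hδ1 hA.isClosed hA.norm_le
    (hA.selfBoundingLoss hG hL hρ) hA.nonneg_reg hA.lipschitz_reg hA.error_bound).imp_right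
    fun hfast _ => hfast
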